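/- Let $\Sigma$ be a finite alphabet. An automaton $A=(Q,\Sigma,\delta,q_0,F)$ has a finite set $Q$ of states, transitions $\delta\subseteq Q\times\Sigma\times Q$, one initial state $q_0$ and a set $F$ of final states; it is deterministic if $(p,a,q),(p,a,q')\in\delta$ implies $q=q'$. A subset of $\mathbb{N}^d$ is semilinear if it is a finite union of sets $\bar c+P^*$ with $\bar c\in\mathbb{N}^d$ and $P\subseteq\mathbb{N}^d$ finite, $P^*$ being the submonoid generated by $P$. A Parikh automaton (PA) over $\Sigma$ consists of an integer $d>0$, a finite set $D\subset\mathbb{N}^d$, an automaton $A$ over $\Sigma\times D$ and a semilinear set $C\subseteq\mathbb{N}^d$; its language is the set of words $a_1\cdots a_k\in\Sigma^*$ for which $A$ accepts some word $(a_1,\bar v_1)\cdots(a_k,\bar v_k)$ with $\sum_i\bar v_i\in C$. It is deterministic (DetPA) if for every state $q$ and every $a\in\Sigma$ there is at most one pair $(q',\bar v)$ such that $(q,(a,\bar v),q')$ is a transition. A constrained automaton (CA) over $\Sigma$ is a pair $(A,C)$ of an automaton $A$ over $\Sigma$ with transition set $\delta$ and a semilinear set $C\subseteq\mathbb{N}^{\delta}$;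 its language is the set of labels of those accepting paths $\pi$ of $A$ for which the vector $(\text{number of occurrences of } t \text{ in } \pi)_{t\in\delta}$ lies in $C$. It is deterministic (DetCA) if $A$ is, and flat if $A$ is. Here $A$ is flat if it consists precisely of distinct states $q_0,\dots,q_n$, with $q_0$ initial and $q_n$ the only final state, exactly one transition from $q_i$ to $q_{i+1}$ for each $0\le i<n$, and finitely many nonempty return paths, each leading from some $q_j$ to some $q_i$ with $i\le j$, such that the intermediate states (if any) of the return paths are distinct from each other, from those of the other return paths and from $q_0,\dots,q_n$, and such that no return path from $q_j$ to $q_i$ coexists with another one having an end among $q_i,\dots,q_j$. A language $L\subseteq\Sigma^*$ is bounded if $L\subseteq w_1^*w_2^*\cdots w_n^*$ for some $n>0$ and some nonempty words $w_1,\dots,w_n\in\Sigma^+$. Let $\mathcal{L}_{\mathrm{BoundedPA}}$ (resp. $\mathcal{L}_{\mathrm{BoundedDetPA}}$) be the class of bounded languages that are the language of some PA (resp. DetPA). Theorem. Every $L\in\mathcal{L}_{\mathrm{BoundedPA}}$ is the union of the languages of finitely many flat DetCA. Moreover, $\mathcal{L}_{\mathrm{BoundedPA}}=\mathcal{L}_{\mathrm{BoundedDetPA}}$.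 -/

import Mathlib

/-! Finite automata, Parikh automata, constrained automata, flat automata, bounded languages. -/

namespace BoundedParikh

/-- A (nondeterministic) automaton `(Q, Σ, δ, q₀, F)` with state set `σ` and alphabet `α`:
one initial state, a set of final states, and a set of labelled transitions. Finiteness of the
state set is required below, where automata are used. -/
structure Automaton (α : Type*) (σ : Type*) where
  /-- the transitions `(p, a, q)` -/
  trans : Set (σ × α × σ)
  /-- the initial state -/
  start : σ
  /-- the final states -/
  accept : Set σ

namespace Automaton

variable {α σ : Type*} (A : Automaton α σ)

/-- The source of a transition. -/
def src (t : A.trans) : σ := t.1.1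

/-- The letter of a transition. -/
def letter (t : A.trans) : α := t.1.2.1

/-- The target of a transition. -/
def tgt (t : A.trans) : σ := t.1.2.2

/-- `A.IsPath p π q`: the word `π` of consecutive transitions leads from `p` to `q`
(the empty path leads from each state to itself). -/
def IsPath : σ → List A.trans → σ → Prop
  | p, [], q => p = q
  | p, t :: π, q => A.src t = p ∧ IsPath (A.tgt t) π q

/-- The label of a word of transitions. -/
def label (π : List A.trans) : List α := π.map A.letter

/-- The language, over the alphabet of transitions, of the accepting paths. -/
def runs : Language A.trans := {π | ∃ q ∈ A.accept, A.IsPath A.start π q}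

/-- The language of the automaton: the labels of the accepting paths. -/
def language : Language α := {w | ∃ π ∈ A.runs, A.label π = w}

/-- For each state and letter there is at most one transition. -/
def IsDeterministic : Prop :=
  ∀ p a q q', (p, a, q) ∈ A.trans → (p, a, q') ∈ A.trans → q = q'

/-- The intermediate states of a path, i.e. all states visited except the two ends. -/
def innerStates (π : List A.trans) : List σ := π.tail.map A.src

/-- The data of a flat automaton: a spine of states `spine 0, …, spine n` and finitely many
return paths, the `k`-th one leading from `spine (hi k)` to `spine (lo k)` with `lo k ≤ hi k`. -/
structure FlatDecomposition where
  /-- the spine has `n + 1` states -/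
  n : ℕ
  /-- the states of the spine -/
  spine : Fin (n + 1) → σ
  /-- the number of return paths -/
  m : ℕ
  /-- the index on the spine at which a return path begins -/
  hi : Fin m → Fin (n + 1)
  /-- the index on the spine at which a return path ends -/
  lo : Fin m → Fin (n + 1)
  /-- the return paths -/
  back : Fin m → List A.trans
  spine_injective : Function.Injective spine
  /-- the spine begins in the initial state -/
  start_eq : A.start = spine 0
  /-- the spine ends in the final state -/
  accept_eq : A.accept = {spine (Fin.last n)}
  /-- exactly one transition from each state of the spine to the next one -/
  spine_step : ∀ i : Fin n, ∃! t : A.trans, A.src t = spine i.castSucc ∧ A.tgt t = spine i.succ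
  lo_le_hi : ∀ k, lo k ≤ hi k
  back_ne_nil : ∀ k, back k ≠ []
  back_isPath : ∀ k, A.IsPath (spine (hi k)) (back k) (spine (lo k))
  /-- the intermediate states of a return path are not on the spine … -/
  back_fresh : ∀ k, ∀ s ∈ A.innerStates (back k), s ∉ Set.range spine
  /-- … they are pairwise distinct … -/
  back_nodup : ∀ k, (A.innerStates (back k)).Nodup
  /-- … and they are on no other return path -/
  back_disjoint : ∀ k l, k ≠ l → (A.innerStates (back k)).Disjoint (A.innerStates (back l))
  /-- no return path has an end between the two ends (inclusive) of another return path;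
  in particular there is at most one return path between any two states of the spine -/
  not_nested : ∀ k l, k ≠ l → lo l ∉ Set.Icc (lo k) (hi k) ∧ hi l ∉ Set.Icc (lo k) (hi k)
  /-- there are no other states -/
  cover_states : ∀ s, s ∈ Set.range spine ∨ ∃ k, s ∈ A.innerStates (back k)
  /-- there are no other transitions -/
  cover_trans : ∀ t : A.trans,
    (∃ i : Fin n, A.src t = spine i.castSucc ∧ A.tgt t = spine i.succ) ∨ ∃ k, t ∈ back k

/-- The automaton is flat. -/
def IsFlat : Prop := Nonempty A.FlatDecomposition

end Automaton

open Classical in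
/-- The Parikh image of a word: the number of occurrences of each letter. -/
noncomputable def parikh {τ : Type*} (w : List τ) : τ → ℕ := fun a => w.count a

/-- A constrained automaton over `α`: a finite automaton together with a semilinear set of
vectors with one coordinate for each transition. -/
structure ConstrainedAutomaton (α : Type*) where
  /-- the set of states -/
  State : Type
  finite_state : Finite State
  /-- the underlying automaton -/
  aut : Automaton α State
  /-- the constraint set -/
  constr : Set (aut.trans → ℕ)
  semilinear : IsSemilinearSet constr

namespace ConstrainedAutomaton

variable {α : Type*} (M : ConstrainedAutomaton α)

/-- The labels of the accepting paths whose Parikh image lies in the constraint set. -/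
def language : Language α :=
  {w | ∃ π ∈ M.aut.runs, parikh π ∈ M.constr ∧ M.aut.label π = w}

/-- The constrained automaton is deterministic (a DetCA). -/
def IsDeterministic : Prop := M.aut.IsDeterministic

/-- The constrained automaton is flat. -/
def IsFlat : Prop := M.aut.IsFlat

end ConstrainedAutomaton

/-- A Parikh automaton of dimension `d > 0` over `α × D`, with `D ⊆ ℕ^d` finite: a finite
automaton over `α × D` together with a semilinear subset of `ℕ^d`. -/
structure ParikhAutomaton (α : Type*) where
  /-- the dimension -/
  d : ℕ
  d_pos : 0 < d
  /-- the finite set of vectors used as labels -/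
  D : Finset (Fin d → ℕ)
  /-- the set of states -/
  State : Type
  finite_state : Finite State
  /-- the underlying automaton -/
  aut : Automaton (α × D) State
  /-- the constraint set -/
  constr : Set (Fin d → ℕ)
  semilinear : IsSemilinearSet constr

namespace ParikhAutomaton

variable {α : Type*} (M : ParikhAutomaton α)

/-- The projection of a word over `α × D` on `α`. -/
def proj (ω : List (α × M.D)) : List α := ω.map Prod.fst

/-- The extended Parikh image of a word over `α × D`: the sum of its vectors. -/
def extParikh (ω : List (α × M.D)) : Fin M.d → ℕ := (ω.map fun x => (x.2 : Fin M.d → ℕ)).sum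

/-- The language of the Parikh automaton. -/
def language : Language α :=
  {w | ∃ ω ∈ M.aut.language, M.extParikh ω ∈ M.constr ∧ M.proj ω = w}

/-- The Parikh automaton is deterministic (a DetPA): for each state `q` and each letter `a : α`
there is at most one pair `(q', v)` such that `(q, (a, v), q')` is a transition. -/
def IsDeterministic : Prop :=
  ∀ q a q₁ v₁ q₂ v₂, (q, (a, v₁), q₁) ∈ M.aut.trans → (q, (a, v₂), q₂) ∈ M.aut.trans →
    (q₁, v₁) = (q₂, v₂)

end ParikhAutomaton

open scoped Computability in
/-- A language is bounded if it is contained in `w₁* w₂* ⋯ wₙ*` for some `n > 0` and some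
nonempty words `w₁, …, wₙ`. -/
def IsBounded {α : Type*} (L : Language α) : Prop :=
  ∃ ws : List (List α), ws ≠ [] ∧ (∀ w ∈ ws, w ≠ []) ∧
    L ≤ (ws.map fun w => ({w} : Language α)∗).prod

/-- The class of bounded languages over `α` recognized by Parikh automata. -/
def boundedPA (α : Type*) : Set (Language α) :=
  {L | (∃ M : ParikhAutomaton α, M.language = L) ∧ IsBounded L}

/-- The class of bounded languages over `α` recognized by deterministic Parikh automata. -/
def boundedDetPA (α : Type*) : Set (Language α) :=
  {L | (∃ M : ParikhAutomaton α, M.IsDeterministic ∧ M.language = L) ∧ IsBounded L}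

end BoundedParikh

/-! A bounded language lies in a regular language w₁*⋯wₙ*, which has polynomially many words of each
length. In a trim deterministic automaton for it no state lies on two different cycles: otherwise
the language would contain some x{u,v}*y with |u| = |v| and u ≠ v, hence exponentially many words.
So its cycles are disjoint (`cyclesDisjoint_trim`).

Disjointness has two consequences. First, a run is determined by its Parikh image
(`CyclesDisjoint.eq_of_parikh_eq`): allowing exactly the Parikh images of the runs whose label is in
L therefore accepts no word outside L (`mem_language_constrain`). These images form a semilinear
set, by a Parikh-style argument on the product with the Parikh automaton
(`isSemilinearSet_parikh_runs`). Second, each run lives in a flat subautomaton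
(`CyclesDisjoint.exists_isFlat_restrict`): erasing loops leaves a simple path, the spine, and each
cycle used by the run is closed by one return path between spine states.

Only finitely many automata live on subsets of the states, which gives the finite union.
Constraining the whole deterministic automaton and labelling its transitions by unit vectors gives a
DetPA. -/

namespace BoundedParikh
open Pointwise

/-! ### Semilinearity of the weights of walks -/

/-- The weights of the nonempty walks from `p` to `q` whose intermediate vertices lie in `T`, where
`G p q` is the set of weights of the edges from `p` to `q`. -/
inductive WalkWeight {V N : Type*} [AddCommMonoid N] (G : V → V → Set N) (T : Set V) :
    V → V → N → Prop
  | edge {p q : V} {w : N} : w ∈ G p q → WalkWeight G T p q w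
  | comp {p r q : V} {w w' : N} : r ∈ T → WalkWeight G T p r w → WalkWeight G T r q w' →
      WalkWeight G T p q (w + w')

namespace WalkWeight

variable {V N : Type*} [AddCommMonoid N] {G : V → V → Set N} {T T' : Set V}

theorem mono (h : T ⊆ T') {p q : V} {w : N} (hw : WalkWeight G T p q w) :
    WalkWeight G T' p q w := by
  induction hw with
  | edge hw => exact .edge hw
  | comp hr _ _ ih₁ ih₂ => exact .comp (h hr) ih₁ ih₂

theorem loop_closure {s q : V} {c w : N} (hs : s ∈ T)
    (hc : c ∈ AddSubmonoid.closure {w | WalkWeight G T s s w}) (hw : WalkWeight G T s q w) :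
    WalkWeight G T s q (c + w) := by
  induction hc using AddSubmonoid.closure_induction_left with
  | zero => simpa using hw
  | add_left x hx y _ ih => rw [add_assoc]; exact .comp hs hx ih

/-- Kleene's state elimination: a walk through s splits into the part before the first visit, loops
at s, and the part after the last visit. As weights commute, the loops contribute an arbitrary
element of a submonoid. -/
theorem insert_iff {s p q : V} {w : N} :
    WalkWeight G (insert s T) p q w ↔ WalkWeight G T p q w ∨
      ∃ a c b, WalkWeight G T p s a ∧ c ∈ AddSubmonoid.closure {w | WalkWeight G T s s w} ∧
        WalkWeight G T s q b ∧ w = a + c + b := by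
  constructor
  · intro h
    induction h with
    | edge hw => exact .inl (.edge hw)
    | @comp p r q w w' hr _ _ ih₁ ih₂ =>
      rcases hr with rfl | hr
      · right
        rcases ih₁ with h₁ | ⟨a, c, b, ha, hc, hb, rfl⟩ <;>
          rcases ih₂ with h₂ | ⟨a', c', b', ha', hc', hb', rfl⟩
        · exact ⟨_, 0, _, h₁, zero_mem _, h₂, by simp⟩
        · exact ⟨_, a' + c', _, h₁, add_mem (AddSubmonoid.subset_closure ha') hc', hb', by abel⟩
        · exact ⟨_, c + b, _, ha, add_mem hc (AddSubmonoid.subset_closure hb), h₂, by abel⟩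
        · exact ⟨_, (c + b) + (a' + c'), _, ha, add_mem
            (add_mem hc (AddSubmonoid.subset_closure hb))
            (add_mem (AddSubmonoid.subset_closure ha') hc'), hb', by abel⟩
      · rcases ih₁ with h₁ | ⟨a, c, b, ha, hc, hb, rfl⟩ <;>
          rcases ih₂ with h₂ | ⟨a', c', b', ha', hc', hb', rfl⟩
        · exact .inl (.comp hr h₁ h₂)
        · exact .inr ⟨_, c', _, .comp hr h₁ ha', hc', hb', by abel⟩
        · exact .inr ⟨_, c, _, ha, hc, .comp hr hb h₂, by abel⟩
        -- The end of the first walk and the beginning of the second join at r ∈ T into one more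
        -- loop at s.
        · exact .inr ⟨_, c + (b + a') + c', _, ha, add_mem (add_mem hc
            (AddSubmonoid.subset_closure (.comp hr hb ha'))) hc', hb', by abel⟩
  · have hT : T ⊆ insert s T := Set.subset_insert _ _
    rintro (h | ⟨a, c, b, ha, hc, hb, rfl⟩)
    · exact h.mono hT
    · rw [add_assoc]
      exact .comp (Set.mem_insert _ _) (ha.mono hT) (loop_closure (Set.mem_insert _ _)
        (AddSubmonoid.closure_mono (fun w (hw : WalkWeight G T s s w) => hw.mono hT) hc)
        (hb.mono hT))

theorem isSemilinearSet (hG : ∀ p q, IsSemilinearSet (G p q)) (hT : T.Finite) (p q : V) :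
    IsSemilinearSet {w | WalkWeight G T p q w} := by
  induction T, hT using Set.Finite.induction_on generalizing p q with
  | empty =>
    convert hG p q using 1
    ext w
    refine ⟨fun h => ?_, .edge⟩
    cases h with
    | edge h => exact h
    | comp h _ _ => exact h.elim
  | @insert s T _ _ ih =>
    have := (ih p q).union (((ih p s).add (ih s s).closure).add (ih s q))
    convert this using 1
    ext w
    simp only [Set.mem_ofPred_eq, insert_iff, Set.mem_union, Set.mem_add, SetLike.mem_coe]
    grind

end WalkWeight

/-! ### Parikh images, paths, and the product with a Parikh automaton -/

section Parikh

variable {τ : Type*}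

theorem parikh_nil : parikh ([] : List τ) = 0 := by
  ext; simp [parikh]

theorem parikh_append (π π' : List τ) : parikh (π ++ π') = parikh π + parikh π' := by
  ext; simp [parikh]

theorem parikh_cons (t : τ) (π : List τ) : parikh (t :: π) = parikh [t] + parikh π :=
  parikh_append [t] π

theorem parikh_pos_iff {t : τ} {π : List τ} : 0 < parikh π t ↔ t ∈ π := by
  classical simp [parikh]

end Parikh

namespace Automaton

variable {α σ : Type*} {A : Automaton α σ}

theorem isPath_append {p q : σ} {π π' : List A.trans} :
    A.IsPath p (π ++ π') q ↔ ∃ r, A.IsPath p π r ∧ A.IsPath r π' q := by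
  induction π generalizing p with
  | nil => simp [IsPath]
  | cons t π ih => simp only [List.cons_append, IsPath, ih]; grind

theorem IsPath.append {p q r : σ} {π π' : List A.trans} (h : A.IsPath p π q)
    (h' : A.IsPath q π' r) : A.IsPath p (π ++ π') r := isPath_append.2 ⟨q, h, h'⟩

theorem isPath_singleton (t : A.trans) : A.IsPath (A.src t) [t] (A.tgt t) := ⟨rfl, rfl⟩

theorem IsPath.tgt_unique {p q q' : σ} {π : List A.trans} (h : A.IsPath p π q)
    (h' : A.IsPath p π q') : q = q' := by
  induction π generalizing p with
  | nil => exact h.symm.trans h'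
  | cons t π ih => exact ih h.2 h'.2

end Automaton

namespace ParikhAutomaton

variable {α S : Type*}

theorem extParikh_append (M : ParikhAutomaton α) (ω ω' : List (α × M.D)) :
    M.extParikh (ω ++ ω') = M.extParikh ω + M.extParikh ω' := by
  simp [extParikh]

/-- The weights of the edges of the product of an automaton and a Parikh automaton. -/
def prodWeight (A : Automaton α S) (M : ParikhAutomaton α) (x y : S × M.State) :
    Set ((A.trans → ℕ) × (Fin M.d → ℕ)) :=
  (fun e : A.trans × M.aut.trans => (parikh [e.1], M.extParikh (M.aut.label [e.2]))) ''
    {e | A.IsPath x.1 [e.1] y.1 ∧ M.aut.IsPath x.2 [e.2] y.2 ∧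
      A.label [e.1] = M.proj (M.aut.label [e.2])}

/-- A walk in the product is a pair of paths with the same label over `α`, so semilinearity of walk
weights applies to such pairs. -/
theorem walkWeight_prodWeight_iff {A : Automaton α S} {M : ParikhAutomaton α} {x y : S × M.State}
    {w : (A.trans → ℕ) × (Fin M.d → ℕ)} :
    WalkWeight (prodWeight A M) Set.univ x y w ↔ ∃ π ρ, π ≠ [] ∧ A.IsPath x.1 π y.1 ∧
      M.aut.IsPath x.2 ρ y.2 ∧ A.label π = M.proj (M.aut.label ρ) ∧
      w = (parikh π, M.extParikh (M.aut.label ρ)) := by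
  constructor
  · intro h
    induction h with
    | edge h =>
      obtain ⟨e, ⟨h₁, h₂, h₃⟩, rfl⟩ := h
      exact ⟨[e.1], [e.2], by simp, h₁, h₂, h₃, rfl⟩
    | comp _ _ _ ih₁ ih₂ =>
      obtain ⟨π, ρ, h₀, h₁, h₂, h₃, rfl⟩ := ih₁
      obtain ⟨π', ρ', -, h₁', h₂', h₃', rfl⟩ := ih₂
      refine ⟨π ++ π', ρ ++ ρ', by simp [h₀], h₁.append h₁', h₂.append h₂', ?_, ?_⟩
      · simp only [Automaton.label, proj, List.map_append] at *
        rw [h₃, h₃']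
      · simp [parikh_append, Automaton.label, extParikh_append]
  · rintro ⟨π, ρ, h₀, h₁, h₂, h₃, rfl⟩
    induction π generalizing ρ x with
    | nil => exact (h₀ rfl).elim
    | cons t π ih =>
      cases ρ with
      | nil => simp [Automaton.label, proj] at h₃
      | cons u ρ =>
        have h₃' : A.label [t] = M.proj (M.aut.label [u]) ∧
            A.label π = M.proj (M.aut.label ρ) := by
          simpa [Automaton.label, proj] using h₃
        have he : WalkWeight (prodWeight A M) Set.univ x (A.tgt t, M.aut.tgt u)
            (parikh [t], M.extParikh (M.aut.label [u])) :=
          .edge ⟨(t, u), ⟨⟨h₁.1, rfl⟩, ⟨h₂.1, rfl⟩, h₃'.1⟩, rfl⟩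
        by_cases hπ : π = []
        · subst hπ
          cases ρ with
          | nil =>
            have : y = (A.tgt t, M.aut.tgt u) := Prod.ext h₁.2.symm h₂.2.symm
            rw [this]
            exact he
          | cons _ _ => simp [Automaton.label, proj] at h₃'
        · have := ih (x := (A.tgt t, M.aut.tgt u)) ρ hπ h₁.2 h₂.2 h₃'.2
          convert WalkWeight.comp (Set.mem_univ _) he this using 1
          rw [parikh_cons]
          simp [Automaton.label, extParikh]

/-- The Parikh images of the runs of an automaton with label in the language of a Parikh
automaton form a semilinear set. -/
theorem isSemilinearSet_parikh_runs [Finite α] [Finite S] (A : Automaton α S)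
    (M : ParikhAutomaton α) :
    IsSemilinearSet {v | ∃ π ∈ A.runs, A.label π ∈ M.language ∧ parikh π = v} := by
  have := M.finite_state
  have hG : ∀ x y, IsSemilinearSet (prodWeight A M x y) := fun x y =>
    .of_finite ((Set.toFinite _).image _)
  -- `WalkWeight` covers nonempty walks only; the second set adds the empty run.
  let W (y : S × M.State) : Set ((A.trans → ℕ) × (Fin M.d → ℕ)) :=
    {w | WalkWeight (prodWeight A M) Set.univ (A.start, M.aut.start) y w} ∪
      {w | w = 0 ∧ (A.start, M.aut.start) = y}
  have hW : ∀ y, IsSemilinearSet (W y) := fun y =>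
    (WalkWeight.isSemilinearSet hG Set.finite_univ _ _).union
      (.of_finite ((Set.finite_singleton 0).subset fun w hw => hw.1))
  have hE : IsSemilinearSet (⋃ y ∈ A.accept ×ˢ M.aut.accept, W y) :=
    .biUnion (Set.toFinite _) fun y _ => hW y
  have hC := M.semilinear.preimage (AddMonoidHom.snd (A.trans → ℕ) (Fin M.d → ℕ))
  -- Keep the pairs whose second component meets the constraint of `M`, then project to the Parikh
  -- image of the run of `A`.
  convert (hE.inter hC).image (AddMonoidHom.fst (A.trans → ℕ) (Fin M.d → ℕ)) using 1
  have hWy : ∀ y w, w ∈ W y ↔ ∃ π ρ, A.IsPath A.start π y.1 ∧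
      M.aut.IsPath M.aut.start ρ y.2 ∧ A.label π = M.proj (M.aut.label ρ) ∧
      w = (parikh π, M.extParikh (M.aut.label ρ)) := by
    intro y w
    simp only [W, Set.mem_union, Set.mem_ofPred_eq, walkWeight_prodWeight_iff]
    constructor
    · rintro (⟨π, ρ, -, h⟩ | ⟨rfl, rfl⟩)
      · exact ⟨π, ρ, h⟩
      · exact ⟨[], [], rfl, rfl, rfl, by rw [parikh_nil]; rfl⟩
    · rintro ⟨π, ρ, h₁, h₂, h₃, rfl⟩
      by_cases hπ : π = []
      · subst hπ
        cases ρ with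
        | nil => exact .inr ⟨by rw [parikh_nil]; rfl, Prod.ext h₁ h₂⟩
        | cons _ _ => simp [Automaton.label, proj] at h₃
      · exact .inl ⟨π, ρ, hπ, h₁, h₂, h₃, rfl⟩
  ext v
  simp only [Set.mem_image, Set.mem_inter_iff, Set.mem_iUnion, hWy, Set.mem_ofPred_eq]
  constructor
  · rintro ⟨π, ⟨q, hq, hπ⟩, ⟨ω, ⟨ρ, ⟨r, hr, hρ⟩, rfl⟩, hC, hl⟩, rfl⟩
    exact ⟨_, ⟨⟨(q, r), ⟨hq, hr⟩, π, ρ, hπ, hρ, hl.symm, rfl⟩, hC⟩, rfl⟩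
  · rintro ⟨_, ⟨⟨y, ⟨hq, hr⟩, π, ρ, hπ, hρ, hl, rfl⟩, hC⟩, rfl⟩
    exact ⟨π, ⟨_, hq, hπ⟩, ⟨_, ⟨ρ, ⟨_, hr, hρ⟩, rfl⟩, hC, hl.symm⟩, rfl⟩

end ParikhAutomaton
end BoundedParikh

/-! ### Loop erasure and automata with disjoint cycles -/

namespace BoundedParikh
namespace Automaton

variable {α σ : Type*} {A : Automaton α σ}

/-- Some path leads from `p` to `q`. -/
def Reaches (A : Automaton α σ) (p q : σ) : Prop := ∃ π, A.IsPath p π q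

theorem Reaches.refl (p : σ) : A.Reaches p p := ⟨[], rfl⟩

theorem Reaches.trans {p q r : σ} : A.Reaches p q → A.Reaches q r → A.Reaches p r :=
  fun ⟨π, h⟩ ⟨π', h'⟩ => ⟨π ++ π', h.append h'⟩

theorem IsPath.reaches {p q : σ} {π : List A.trans} (h : A.IsPath p π q) : A.Reaches p q := ⟨π, h⟩

theorem reaches_src_tgt (t : A.trans) : A.Reaches (A.src t) (A.tgt t) := ⟨[t], isPath_singleton t⟩

theorem IsPath.exists_eq_append_cons {p q : σ} {π : List A.trans} (h : A.IsPath p π q)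
    {t : A.trans} (ht : t ∈ π) :
    ∃ a b, π = a ++ t :: b ∧ A.IsPath p a (A.src t) ∧ A.IsPath (A.tgt t) b q := by
  obtain ⟨a, b, rfl⟩ := List.append_of_mem ht
  obtain ⟨r, ha, rfl, hb⟩ := isPath_append.1 h
  exact ⟨a, b, rfl, ha, hb⟩

theorem IsPath.reaches_src {p q : σ} {π : List A.trans} (h : A.IsPath p π q)
    {t : A.trans} (ht : t ∈ π) : A.Reaches p (A.src t) := by
  obtain ⟨a, b, -, ha, -⟩ := h.exists_eq_append_cons ht
  exact ha.reaches

theorem IsPath.tgt_reaches {p q : σ} {π : List A.trans} (h : A.IsPath p π q)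
    {t : A.trans} (ht : t ∈ π) : A.Reaches (A.tgt t) q := by
  obtain ⟨a, b, -, -, hb⟩ := h.exists_eq_append_cons ht
  exact hb.reaches

/-- The states of a path, with and without the first or last one. -/
theorem IsPath.cons_map_tgt {p q : σ} {π : List A.trans} (h : A.IsPath p π q) :
    p :: π.map A.tgt = π.map A.src ++ [q] := by
  induction π generalizing p with
  | nil => cases h; rfl
  | cons t π ih =>
    obtain ⟨rfl, h⟩ := h
    simp [← ih h]

theorem IsPath.exists_tgt_eq {p q : σ} {π : List A.trans} (h : A.IsPath p π q) (h₀ : π ≠ []) :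
    ∃ t ∈ π, A.tgt t = q := by
  have h₁ := h.cons_map_tgt
  cases π with
  | nil => exact (h₀ rfl).elim
  | cons t π =>
    simp only [List.map_cons, List.cons_append, List.cons.injEq] at h₁
    have : q ∈ A.tgt t :: π.map A.tgt := by rw [h₁.2]; simp
    rw [← List.map_cons] at this
    exact List.mem_map.1 this

theorem isPath_flatten_replicate {p : σ} {c : List A.trans} (h : A.IsPath p c p) (n : ℕ) :
    A.IsPath p (List.replicate n c).flatten p := by
  induction n with
  | zero => rfl
  | succ n ih => exact h.append ih

/-- Any two cycles are disjoint: of the transitions leaving a state, at most one can be followed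
by a path that returns to the state. -/
def CyclesDisjoint (A : Automaton α σ) : Prop :=
  ∀ t t' : A.trans, A.src t = A.src t' → A.Reaches (A.tgt t) (A.src t) →
    A.Reaches (A.tgt t') (A.src t') → t = t'

/-- A path from a given state is determined by its Parikh image. -/
theorem CyclesDisjoint.eq_of_parikh_eq (hA : A.CyclesDisjoint) {p q q' : σ}
    {π π' : List A.trans} (h : A.IsPath p π q) (h' : A.IsPath p π' q')
    (he : parikh π = parikh π') : π = π' := by
  have hmem : ∀ t, t ∈ π ↔ t ∈ π' := fun t => by rw [← parikh_pos_iff, he, parikh_pos_iff]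
  induction π generalizing p π' with
  | nil =>
    cases π' with
    | nil => rfl
    | cons t' π' => simpa using hmem t'
  | cons t π ih =>
    cases π' with
    | nil => simpa using hmem t
    | cons t' π' =>
      -- If the first transitions differed, each would occur later in the other path, so both would
      -- start cycles at the same state.
      have htt : t = t' := by
        by_contra hne
        have h₁ : t ∈ π' := (List.mem_cons.1 ((hmem t).1 (by simp))).resolve_left hne
        have h₂ : t' ∈ π := (List.mem_cons.1 ((hmem t').2 (by simp))).resolve_left (Ne.symm hne)
        have hs : A.src t = A.src t' := h.1.trans h'.1.symm
        exact hne (hA t t' hs (hs ▸ h.2.reaches_src h₂) (hs ▸ h'.2.reaches_src h₁))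
      subst htt
      rw [parikh_cons, parikh_cons t π'] at he
      have he' := add_left_cancel he
      rw [ih h.2 h'.2 he' fun t => by rw [← parikh_pos_iff, he', parikh_pos_iff]]

/-- Two paths from a given state inside its strongly connected component are comparable. -/
theorem CyclesDisjoint.prefix_or_prefix (hA : A.CyclesDisjoint) {p q q' : σ}
    {π π' : List A.trans} (h : A.IsPath p π q) (h' : A.IsPath p π' q')
    (hq : A.Reaches q p) (hq' : A.Reaches q' p) : π <+: π' ∨ π' <+: π := by
  induction π generalizing p π' with
  | nil => exact .inl List.nil_prefix
  | cons t π ih =>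
    cases π' with
    | nil => exact .inr List.nil_prefix
    | cons t' π' =>
      obtain ⟨rfl, h⟩ := h
      obtain ⟨hs, h'⟩ := h'
      obtain rfl : t = t' := hA t t' hs.symm (h.reaches.trans hq) (hs ▸ h'.reaches.trans hq')
      simpa using ih h h' (hq.trans (reaches_src_tgt t)) (hq'.trans (reaches_src_tgt t))

/-- A closed path runs through all transitions of the strongly connected component. -/
theorem CyclesDisjoint.subset_of_isPath (hA : A.CyclesDisjoint) {p q : σ} {c π : List A.trans}
    (hc : A.IsPath p c p) (hc₀ : c ≠ []) (h : A.IsPath p π q) (hq : A.Reaches q p) : π ⊆ c := by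
  -- Winding |π| times round c gives a path at least as long as π, and the two are comparable as
  -- prefixes.
  have hl := isPath_flatten_replicate hc π.length
  have hmem : ∀ n, (List.replicate n c).flatten ⊆ c := fun n t ht => by
    obtain ⟨l, hl, ht⟩ := List.mem_flatten.1 ht
    rwa [List.eq_of_mem_replicate hl] at ht
  rcases hA.prefix_or_prefix h hl hq (.refl p) with h | h
  · exact List.Subset.trans h.subset (hmem _)
  · have : (List.replicate π.length c).flatten = π := by
      refine h.eq_of_length_le ?_
      have := List.length_pos_iff.2 hc₀
      simp only [List.length_flatten, List.map_replicate, List.sum_replicate, smul_eq_mul]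
      exact Nat.le_mul_of_pos_right _ this
    rw [← this]
    exact hmem _

/-- Erasing the loops of a path keeps the transitions that are on no cycle, and a state in the
strongly connected component of each state of the path. -/
theorem IsPath.exists_nodup {p q : σ} {π : List A.trans} (h : A.IsPath p π q) :
    ∃ ρ, A.IsPath p ρ q ∧ (p :: ρ.map A.tgt).Nodup ∧
      (∀ t ∈ π, ¬ A.Reaches (A.tgt t) (A.src t) → t ∈ ρ) ∧
      ∀ s ∈ p :: π.map A.tgt, ∃ s' ∈ p :: ρ.map A.tgt, A.Reaches s s' ∧ A.Reaches s' s := by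
  induction π generalizing p with
  | nil =>
    exact ⟨[], h, by simp, by simp, fun s hs => ⟨s, hs, .refl s, .refl s⟩⟩
  | cons t π ih =>
    obtain ⟨rfl, h⟩ := h
    obtain ⟨ρ, hρ, hnd, hbr, hscc⟩ := ih h
    -- If the new state is already on ρ, the initial segment a of ρ up to it closes a cycle with t.
    -- Cutting it off loses only transitions on cycles and states in the component of `A.src t`.
    by_cases hp : A.src t ∈ A.tgt t :: ρ.map A.tgt
    · have hsplit : ∃ a b, ρ = a ++ b ∧ A.IsPath (A.tgt t) a (A.src t) ∧
          A.IsPath (A.src t) b q := by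
        rw [hρ.cons_map_tgt, List.mem_append] at hp
        rcases hp with hp | hp
        · obtain ⟨u, hu, hs⟩ := List.mem_map.1 hp
          obtain ⟨a, b, rfl, ha, hb⟩ := hρ.exists_eq_append_cons hu
          exact ⟨a, u :: b, rfl, hs ▸ ha, hs, hb⟩
        · rw [List.mem_singleton.1 hp]
          exact ⟨ρ, [], by simp, hρ, rfl⟩
      obtain ⟨a, b, rfl, ha, hb⟩ := hsplit
      have hst : A.tgt t :: (a ++ b).map A.tgt = a.map A.src ++ (A.src t :: b.map A.tgt) := by
        rw [List.map_append, ← List.cons_append, ha.cons_map_tgt]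
        simp
      rw [hst] at hnd hscc
      have hta : A.IsPath (A.src t) (t :: a) (A.src t) := ⟨rfl, ha⟩
      refine ⟨b, hb, (List.nodup_append.1 hnd).2.1, ?_, ?_⟩
      · intro u hu hur
        by_contra hub
        have : u ∈ t :: a := by
          rcases List.mem_cons.1 hu with rfl | hu
          · simp
          · have := hbr u hu hur
            simp only [List.mem_append] at this
            exact List.mem_cons_of_mem _ (this.resolve_right hub)
        exact hur ((hta.tgt_reaches this).trans (hta.reaches_src this))
      · intro s hs
        rcases List.mem_cons.1 hs with rfl | hs
        · exact ⟨_, by simp, .refl _, .refl _⟩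
        · obtain ⟨s', hs', h₁, h₂⟩ := hscc s hs
          rcases List.mem_append.1 hs' with hs' | hs'
          · obtain ⟨u, hu, rfl⟩ := List.mem_map.1 hs'
            refine ⟨A.src t, by simp, h₁.trans ?_, .trans ?_ h₂⟩
            · exact (reaches_src_tgt u).trans (ha.tgt_reaches hu)
            · exact hta.reaches_src (List.mem_cons_of_mem _ hu)
          · exact ⟨s', hs', h₁, h₂⟩
    · refine ⟨t :: ρ, ⟨rfl, hρ⟩, ?_, ?_, ?_⟩
      · rw [List.map_cons]
        exact List.nodup_cons.2 ⟨hp, hnd⟩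
      · intro u hu hur
        rcases List.mem_cons.1 hu with rfl | hu
        · simp
        · exact List.mem_cons_of_mem _ (hbr u hu hur)
      · intro s hs
        rcases List.mem_cons.1 hs with rfl | hs
        · exact ⟨_, by simp, .refl _, .refl _⟩
        · obtain ⟨s', hs', h₁, h₂⟩ := hscc s hs
          exact ⟨s', List.mem_cons_of_mem _ hs', h₁, h₂⟩

/-- A nonempty path can be shortened so that no intermediate state is repeated. -/
theorem IsPath.exists_innerStates_nodup {p q : σ} {π : List A.trans} (h : A.IsPath p π q)
    (h₀ : π ≠ []) : ∃ ρ, ρ ≠ [] ∧ A.IsPath p ρ q ∧ (A.innerStates ρ).Nodup ∧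
      p ∉ A.innerStates ρ ∧ q ∉ A.innerStates ρ := by
  cases π with
  | nil => exact (h₀ rfl).elim
  | cons t π =>
    obtain ⟨rfl, h⟩ := h
    obtain ⟨ρ, hρ, hnd, -⟩ := h.exists_nodup
    rw [hρ.cons_map_tgt] at hnd
    have hq : q ∉ ρ.map A.src := fun hq => (List.nodup_append.1 hnd).2.2 q hq q (by simp) rfl
    replace hnd := (List.nodup_append.1 hnd).1
    by_cases hp : A.src t ∈ ρ.map A.src
    · obtain ⟨u, hu, hs⟩ := List.mem_map.1 hp
      obtain ⟨a, b, rfl, -, hb⟩ := hρ.exists_eq_append_cons hu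
      simp only [List.map_append, List.map_cons] at hnd hq
      have hnd' := List.nodup_cons.1 (List.nodup_append.1 hnd).2.1
      refine ⟨u :: b, by simp, ⟨hs, hb⟩, hnd'.2, ?_, ?_⟩
      · rw [← hs]; exact hnd'.1
      · simp only [innerStates, List.tail_cons]
        grind
    · exact ⟨t :: ρ, by simp, ⟨rfl, hρ⟩, hnd, hp, hq⟩

end Automaton
end BoundedParikh

/-! ### Regularity and growth of w₁*⋯wₙ* -/

namespace BoundedParikh

section Regular

open scoped Computability

variable {α : Type*}

theorem isRegular_singleton (w : List α) : ({w} : Language α).IsRegular := by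
  refine .of_finite_range_leftQuotient (Set.Finite.subset (((Set.finite_Iic w.length).image
    fun k => ({w.drop k} : Language α)).insert 0) ?_)
  rintro _ ⟨x, rfl⟩
  by_cases hx : x <+: w
  · obtain ⟨s, rfl⟩ := hx
    refine .inr ⟨x.length, by simp, ?_⟩
    ext y
    simp only [List.drop_left', Language.mem_leftQuotient]
    exact (List.append_cancel_left_eq x y s ▸ Iff.rfl : y = s ↔ x ++ y = x ++ s)
  · refine .inl (Set.eq_empty_of_forall_notMem fun y hy => hx ⟨y, hy⟩)

/-- Myhill–Nerode: the quotient of `L * M` by x depends only on the quotient of L by x and on the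
set of quotients of M by the suffixes left after a prefix of x in L. Finitely many such pairs exist.
-/
theorem isRegular_mul {L M : Language α} (hL : L.IsRegular) (hM : M.IsRegular) :
    (L * M).IsRegular := by
  let f : Language α × Set (Language α) → Language α := fun x =>
    {y | y ∈ x.1 * M ∨ ∃ N ∈ x.2, y ∈ N}
  refine .of_finite_range_leftQuotient (Set.Finite.subset
    ((hL.finite_range_leftQuotient.prod hM.finite_range_leftQuotient.powerset).image f) ?_)
  rintro _ ⟨x, rfl⟩
  refine ⟨(L.leftQuotient x, {N | ∃ u v, x = u ++ v ∧ u ∈ L ∧ M.leftQuotient v = N}),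
    ⟨⟨x, rfl⟩, ?_⟩, ?_⟩
  · rintro _ ⟨u, v, -, -, rfl⟩
    exact ⟨v, rfl⟩
  · ext y
    change (y ∈ L.leftQuotient x * M ∨
      ∃ N, (∃ u v, x = u ++ v ∧ u ∈ L ∧ M.leftQuotient v = N) ∧ y ∈ N) ↔ x ++ y ∈ L * M
    simp only [Language.mem_mul]
    constructor
    · rintro (⟨a, ha, b, hb, rfl⟩ | ⟨_, ⟨u, v, rfl, hu, rfl⟩, hy⟩)
      · exact ⟨x ++ a, ha, b, hb, by simp⟩
      · exact ⟨u, hu, v ++ y, hy, by simp⟩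
    · rintro ⟨a, ha, b, hb, h⟩
      rcases List.append_eq_append_iff.1 h with ⟨c, rfl, rfl⟩ | ⟨c, rfl, rfl⟩
      · exact .inr ⟨_, ⟨a, c, rfl, ha, rfl⟩, hb⟩
      · exact .inl ⟨c, ha, b, hb, rfl⟩

/-- The boundary between x and y falls inside or at the end of one factor of the factorization,
unless x is empty. This describes the quotients of `L∗` through those of L. -/
theorem append_mem_kstar_iff {L : Language α} {x y : List α} :
    x ++ y ∈ L∗ ↔ (x = [] ∧ y ∈ L∗) ∨
      ∃ u v, x = u ++ v ∧ u ∈ L∗ ∧ y ∈ L.leftQuotient v * L∗ := by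
  constructor
  · intro h
    obtain ⟨l, hl, hL⟩ := Language.mem_kstar.1 h
    clear h
    induction l generalizing x with
    | nil =>
      simp only [List.flatten_nil, List.append_eq_nil_iff] at hl
      exact .inl ⟨hl.1, hl.2 ▸ Language.nil_mem_kstar L⟩
    | cons z l ih =>
      have hz : z ∈ L := hL z (by simp)
      have hl' : l.flatten ∈ L∗ :=
        Language.mem_kstar.2 ⟨l, rfl, fun y hy => hL y (List.mem_cons_of_mem _ hy)⟩
      rw [List.flatten_cons] at hl
      rcases List.append_eq_append_iff.1 hl with ⟨c, rfl, rfl⟩ | ⟨c, rfl, hc⟩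
      · refine .inr ⟨[], x, rfl, Language.nil_mem_kstar L, ?_⟩
        exact Language.mem_mul.2 ⟨c, hz, _, hl', rfl⟩
      · rcases ih hc.symm fun y hy => hL y (List.mem_cons_of_mem _ hy) with
          ⟨rfl, hy⟩ | ⟨u, v, rfl, hu, hy⟩
        · exact .inr ⟨[], z, by simp, Language.nil_mem_kstar L,
            Language.mem_mul.2 ⟨[], by simpa using hz, y, hy, rfl⟩⟩
        · refine .inr ⟨z ++ u, v, by simp, ?_, hy⟩
          obtain ⟨l', rfl, hl'⟩ := Language.mem_kstar.1 hu
          exact Language.mem_kstar.2 ⟨z :: l', by simp, by simpa [hz] using hl'⟩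
  · rintro (⟨rfl, hy⟩ | ⟨u, v, rfl, hu, hy⟩)
    · exact hy
    · obtain ⟨a, ha, b, hb, rfl⟩ := Language.mem_mul.1 hy
      obtain ⟨l, rfl, hl⟩ := Language.mem_kstar.1 hu
      obtain ⟨l', rfl, hl'⟩ := Language.mem_kstar.1 hb
      refine Language.mem_kstar.2 ⟨l ++ (v ++ a) :: l', by simp, ?_⟩
      intro y hy
      rcases List.mem_append.1 hy with hy | hy
      · exact hl y hy
      · rcases List.mem_cons.1 hy with rfl | hy
        · exact ha
        · exact hl' y hy

theorem isRegular_kstar {L : Language α} (hL : L.IsRegular) : (L∗).IsRegular := by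
  let f : Prop × Set (Language α) → Language α := fun x =>
    {y | (x.1 ∧ y ∈ L∗) ∨ ∃ N ∈ x.2, y ∈ N * L∗}
  refine .of_finite_range_leftQuotient (Set.Finite.subset
    ((Set.finite_univ.prod hL.finite_range_leftQuotient.powerset).image f) ?_)
  rintro _ ⟨x, rfl⟩
  refine ⟨(x = [], {N | ∃ u v, x = u ++ v ∧ u ∈ L∗ ∧ L.leftQuotient v = N}),
    ⟨trivial, ?_⟩, ?_⟩
  · rintro _ ⟨u, v, -, -, rfl⟩
    exact ⟨v, rfl⟩
  · ext y
    change ((x = [] ∧ y ∈ L∗) ∨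
      ∃ N, (∃ u v, x = u ++ v ∧ u ∈ L∗ ∧ L.leftQuotient v = N) ∧ y ∈ N * L∗) ↔ x ++ y ∈ L∗
    rw [append_mem_kstar_iff]
    grind

theorem isRegular_prod_kstar (ws : List (List α)) :
    (ws.map fun w => ({w} : Language α)∗).prod.IsRegular := by
  induction ws with
  | nil => exact isRegular_singleton []
  | cons w ws ih =>
    rw [List.map_cons, List.prod_cons]
    exact isRegular_mul (isRegular_kstar (isRegular_singleton w)) ih

/-- The number of words of length at most `N` is bounded by a polynomial in `N`. -/
def HasPolynomialGrowth (L : Language α) : Prop :=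
  ∃ n : ℕ, ∀ N : ℕ, ∃ F : Finset (List α),
    (∀ x ∈ L, x.length ≤ N → x ∈ F) ∧ F.card ≤ (N + 1) ^ n

/-- A word is given by its exponents, and each exponent is at most its length because the wᵢ are
nonempty. -/
theorem hasPolynomialGrowth_prod_kstar (ws : List (List α)) (hws : ∀ w ∈ ws, w ≠ []) :
    HasPolynomialGrowth (ws.map fun w => ({w} : Language α)∗).prod := by
  classical
  refine ⟨ws.length, fun N => ?_⟩
  induction ws with
  | nil => exact ⟨{[]}, fun x hx _ => Finset.mem_singleton.2 hx, by simp⟩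
  | cons w ws ih =>
    obtain ⟨F, hF, hcard⟩ := ih fun w hw => hws w (List.mem_cons_of_mem _ hw)
    refine ⟨Finset.image₂ (· ++ ·) ((Finset.range (N + 1)).image
      fun k => (List.replicate k w).flatten) F, ?_, ?_⟩
    · intro x hx hN
      rw [List.map_cons, List.prod_cons] at hx
      obtain ⟨a, ha, b, hb, rfl⟩ := Language.mem_mul.1 hx
      obtain ⟨l, rfl, hl⟩ := Language.mem_kstar.1 ha
      have hl' : l = List.replicate l.length w := List.eq_replicate_of_mem hl
      rw [List.length_append] at hN
      refine Finset.mem_image₂_of_mem (Finset.mem_image.2 ⟨l.length, ?_, by rw [← hl']⟩)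
        (hF b hb (by omega))
      have h₁ : l.length * w.length = l.flatten.length := by
        conv_rhs => rw [hl']
        simp
      have h₂ : 0 < w.length := List.length_pos_iff.2 (hws w (by simp))
      have h₃ := Nat.le_mul_of_pos_right l.length h₂
      simp only [Finset.mem_range]
      omega
    · refine Finset.card_image₂_le _ _ _ |>.trans ?_
      rw [List.length_cons, pow_succ']
      exact Nat.mul_le_mul (Finset.card_image_le.trans (by simp)) hcard

theorem exists_pow_lt_two_pow (a n : ℕ) : ∃ k : ℕ, (a * (k + 1)) ^ n < 2 ^ k := by
  -- The factor 2 pays for the shift from k to k + 1 in the power of two.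
  have h := (tendsto_pow_const_div_const_pow_of_one_lt n (one_lt_two (α := ℝ))).const_mul
    (2 * (a : ℝ) ^ n)
  rw [mul_zero] at h
  obtain ⟨k, hk, hk₁⟩ := ((h.eventually_lt_const one_pos).and
    (Filter.eventually_ge_atTop 1)).exists
  obtain ⟨k, rfl⟩ := Nat.exists_eq_add_of_le' hk₁
  refine ⟨k, ?_⟩
  have h2 : (0 : ℝ) < 2 ^ (k + 1) := by positivity
  rw [← mul_div_assoc, div_lt_one h2, pow_succ'] at hk
  have : ((a : ℝ) ^ n * ((k + 1 : ℕ) : ℝ) ^ n) < 2 ^ k := by linarith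
  rw [mul_pow]
  exact_mod_cast this

/-- A language of polynomial growth contains no set `x {u, v}* y` with `u ≠ v` of equal length. -/
theorem HasPolynomialGrowth.not_forall_mem {L : Language α} (hL : HasPolynomialGrowth L)
    {x u v y : List α} (hlen : u.length = v.length) (hne : u ≠ v) :
    ¬ ∀ l : List (List α), (∀ z ∈ l, z = u ∨ z = v) → x ++ l.flatten ++ y ∈ L := by
  intro h
  obtain ⟨n, hn⟩ := hL
  obtain ⟨k, hk⟩ := exists_pow_lt_two_pow (x.length + u.length + y.length + 1) n
  obtain ⟨F, hF, hcard⟩ := hn (x.length + k * u.length + y.length)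
  let l (b : Fin k → Bool) : List (List α) := List.ofFn fun i => if b i then u else v
  have hl : ∀ b, ∀ z ∈ l b, z = u ∨ z = v := by
    intro b z hz
    obtain ⟨i, rfl⟩ := List.mem_ofFn.1 hz
    split_ifs <;> simp
  have hll : ∀ b, (l b).map List.length = List.replicate k u.length := by
    intro b
    refine List.eq_replicate_iff.2 ⟨by simp [l], fun m hm => ?_⟩
    obtain ⟨z, hz, rfl⟩ := List.mem_map.1 hm
    rcases hl b z hz with rfl | rfl <;> simp [hlen]
  have hinj : Function.Injective fun b => x ++ (l b).flatten ++ y := by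
    intro b b' hb
    have h₁ : (l b).flatten = (l b').flatten :=
      List.append_cancel_left (List.append_cancel_right hb)
    -- All blocks have the same length, so the concatenation determines the sequence of blocks.
    have h₂ := (List.eq_iff_flatten_eq (L := l b) (L' := l b')).2 ⟨h₁, (hll b).trans (hll b').symm⟩
    have h₃ := List.ofFn_injective h₂
    funext i
    have := congrFun h₃ i
    cases hb : b i <;> cases hb' : b' i <;> simp_all
  have hle : Fintype.card (Fin k → Bool) ≤ F.card := by
    classical
    rw [← Finset.card_univ]
    refine Finset.card_le_card_of_injOn _ (fun b _ => hF _ (h (l b) (hl b)) ?_) hinj.injOn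
    simp only [List.length_append, List.length_flatten, hll]
    simp
  simp only [Fintype.card_pi, Fintype.card_bool, Finset.prod_const, Finset.card_univ,
    Fintype.card_fin] at hle
  refine absurd (hle.trans hcard) (not_le.2 (lt_of_le_of_lt (Nat.pow_le_pow_left ?_ n) hk))
  nlinarith [Nat.zero_le (k * x.length), Nat.zero_le (k * y.length)]

end Regular

/-! ### Polynomial growth makes the cycles of a trim automaton disjoint -/

section Trim

variable {α Q : Type*}

/-- The trim part of a deterministic automaton. -/
def trim (M : DFA α Q) : Automaton α Q where
  trans := {x | M.step x.1 x.2.1 = x.2.2 ∧ (∃ u, M.eval u = x.1) ∧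
    ∃ v, M.evalFrom x.2.2 v ∈ M.accept}
  start := M.start
  accept := M.accept

variable {M : DFA α Q}

theorem isDeterministic_trim : (trim M).IsDeterministic :=
  fun _ _ _ _ h h' => h.1.symm.trans h'.1

theorem evalFrom_label {p q : Q} {π : List (trim M).trans} (h : (trim M).IsPath p π q) :
    M.evalFrom p ((trim M).label π) = q := by
  induction π generalizing p with
  | nil => exact h
  | cons t π ih =>
    obtain ⟨rfl, h⟩ := h
    rw [← ih h, Automaton.label, List.map_cons, DFA.evalFrom_cons]
    congr 1
    exact t.2.1

theorem accepts_le_language_trim : M.accepts ≤ (trim M).language := by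
  have key : ∀ (w u : List α) (p : Q), M.eval u = p → M.evalFrom p w ∈ M.accept →
      ∃ π, (trim M).IsPath p π (M.evalFrom p w) ∧ (trim M).label π = w := by
    intro w
    induction w with
    | nil => exact fun u p _ _ => ⟨[], rfl, rfl⟩
    | cons a w ih =>
      intro u p hu hw
      rw [DFA.evalFrom_cons] at hw ⊢
      obtain ⟨π, hπ, rfl⟩ := ih (u ++ [a]) (M.step p a) (by simp [hu]) hw
      exact ⟨⟨(p, a, M.step p a), rfl, ⟨u, hu⟩, _, hw⟩ :: π, ⟨rfl, hπ⟩, rfl⟩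
  intro w hw
  obtain ⟨π, hπ, rfl⟩ := key w [] M.start rfl hw
  exact ⟨π, ⟨_, hw, hπ⟩, rfl⟩

/-- By determinism, two cycles leaving a state by different transitions have labels u, v with
different first letters. They can be iterated in any order between an access word and a word leading
to acceptance. -/
theorem cyclesDisjoint_trim (hM : HasPolynomialGrowth M.accepts) : (trim M).CyclesDisjoint := by
  rintro t t' hs ⟨c, hc⟩ ⟨c', hc'⟩
  by_contra hne
  have hlet : (trim M).letter t ≠ (trim M).letter t' := by
    intro hl
    refine hne (Subtype.ext (Prod.ext hs (Prod.ext hl ?_)))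
    rw [← t.2.1, ← t'.2.1]
    exact congrArg₂ M.step hs hl
  have hu := evalFrom_label (show (trim M).IsPath ((trim M).src t) (t :: c) _ from ⟨rfl, hc⟩)
  have hv := evalFrom_label (show (trim M).IsPath ((trim M).src t') (t' :: c') _ from ⟨rfl, hc'⟩)
  rw [← hs] at hv
  have hu₀ : (trim M).label (t :: c) = (trim M).letter t :: (trim M).label c := rfl
  have hv₀ : (trim M).label (t' :: c') = (trim M).letter t' :: (trim M).label c' := rfl
  obtain ⟨x, hx⟩ := t.2.2.1
  obtain ⟨y, hy⟩ := t.2.2.2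
  generalize (trim M).label (t :: c) = u at hu hu₀
  generalize (trim M).label (t' :: c') = v at hv hv₀
  have hrep : ∀ w, M.evalFrom ((trim M).src t) w = (trim M).src t → ∀ n,
      M.evalFrom ((trim M).src t) (List.replicate n w).flatten = (trim M).src t := by
    intro w hw n
    induction n with
    | zero => rfl
    | succ n ih => rw [List.replicate_succ, List.flatten_cons, DFA.evalFrom_of_append, hw, ih]
  -- The powers make the lengths equal. The final word starts with the letter of t since y is read
  -- from the target of t.
  refine hM.not_forall_mem (x := x) (u := (List.replicate v.length u).flatten)
    (v := (List.replicate u.length v).flatten) (y := (trim M).letter t :: y) ?_ ?_ ?_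
  · simp [mul_comm]
  · rw [hu₀, hv₀]
    simp [List.replicate_succ, hlet]
  · intro l hl
    have hl' : M.evalFrom ((trim M).src t) l.flatten = (trim M).src t := by
      induction l with
      | nil => rfl
      | cons z l ih =>
        have hz : M.evalFrom ((trim M).src t) z = (trim M).src t := by
          rcases hl z (by simp) with rfl | rfl
          · exact hrep u hu _
          · exact hrep v hv _
        rw [List.flatten_cons, DFA.evalFrom_of_append, hz]
        exact ih fun z hz => hl z (List.mem_cons_of_mem _ hz)
    rw [DFA.mem_accepts, DFA.eval, DFA.evalFrom_of_append, DFA.evalFrom_of_append]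
    have hx' : M.evalFrom M.start x = (trim M).src t := hx
    rw [hx', hl', DFA.evalFrom_cons]
    have : M.step ((trim M).src t) ((trim M).letter t) = (trim M).tgt t := t.2.1
    rw [this]
    exact hy

end Trim
end BoundedParikh

/-! ### Flat subautomata -/

namespace BoundedParikh
namespace Automaton

variable {α σ : Type*} {A : Automaton α σ}

theorem Reaches.of_mem_innerStates {p q s : σ} {π : List A.trans} (h : A.IsPath p π q)
    (hs : s ∈ A.innerStates π) : A.Reaches p s ∧ A.Reaches s q := by
  obtain ⟨u, hu, rfl⟩ := List.mem_map.1 hs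
  have hu := List.mem_of_mem_tail hu
  exact ⟨h.reaches_src hu, (reaches_src_tgt u).trans (h.tgt_reaches hu)⟩

theorem IsPath.src_mem {p q : σ} {π : List A.trans} (h : A.IsPath p π q) {t : A.trans}
    (ht : t ∈ π) : A.src t = p ∨ A.src t ∈ A.innerStates π := by
  cases π with
  | nil => simp at ht
  | cons u π =>
    rcases List.mem_cons.1 ht with rfl | ht
    · exact .inl h.1
    · exact .inr (List.mem_map_of_mem ht)

theorem IsPath.tgt_mem {p q : σ} {π : List A.trans} (h : A.IsPath p π q) {t : A.trans}
    (ht : t ∈ π) : A.tgt t = q ∨ A.tgt t ∈ A.innerStates π := by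
  cases π with
  | nil => simp at ht
  | cons u π =>
    have h₁ := h.2.cons_map_tgt
    have h₂ : A.tgt t ∈ A.tgt u :: π.map A.tgt := List.mem_map_of_mem (f := A.tgt) ht
    rw [h₁] at h₂
    simpa [innerStates, or_comm] using h₂

/-! ### Restriction to subsets of states and transitions -/

/-- The automaton with states `S` and transitions `T`. -/
def restrict (A : Automaton α σ) (S : Set σ) (T : Set A.trans) (s : S) (F : Set S) :
    Automaton α S where
  trans := {x | ∃ t ∈ T, t.1 = (x.1.1, x.2.1, x.2.2.1)}
  start := s
  accept := F

section Restrict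

variable {S : Set σ} {T : Set A.trans} {s : S} {F : Set S}

/-- The transitions of a restriction are transitions of the automaton. -/
def emb (x : (A.restrict S T s F).trans) : A.trans :=
  ⟨(x.1.1.1, x.1.2.1, x.1.2.2.1), by obtain ⟨t, -, h⟩ := x.2; rw [← h]; exact t.2⟩

theorem emb_mem (x : (A.restrict S T s F).trans) : emb x ∈ T := by
  obtain ⟨t, ht, h⟩ := x.2
  rwa [show emb x = t from Subtype.ext h.symm]

theorem emb_injective : Function.Injective (emb (A := A) (S := S) (T := T) (s := s) (F := F)) := by
  rintro ⟨⟨⟨p, hp⟩, a, ⟨q, hq⟩⟩, h⟩ ⟨⟨⟨p', hp'⟩, a', ⟨q', hq'⟩⟩, h'⟩ he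
  have := congrArg Subtype.val he
  simp only [emb, Prod.mk.injEq] at this
  obtain ⟨rfl, rfl, rfl⟩ := this
  rfl

theorem src_emb (x : (A.restrict S T s F).trans) :
    A.src (emb x) = ((A.restrict S T s F).src x).1 := rfl

theorem tgt_emb (x : (A.restrict S T s F).trans) :
    A.tgt (emb x) = ((A.restrict S T s F).tgt x).1 := rfl

theorem isPath_map_emb {p q : S} {π : List (A.restrict S T s F).trans} :
    A.IsPath p.1 (π.map emb) q.1 ↔ (A.restrict S T s F).IsPath p π q := by
  induction π generalizing p with
  | nil => exact Subtype.ext_iff.symm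
  | cons t π ih =>
    rw [List.map_cons, IsPath, IsPath, tgt_emb, src_emb, ih, Subtype.ext_iff]

theorem label_map_emb (π : List (A.restrict S T s F).trans) :
    A.label (π.map emb) = (A.restrict S T s F).label π := by
  simp only [label, List.map_map]
  rfl

theorem innerStates_map_emb (π : List (A.restrict S T s F).trans) :
    A.innerStates (π.map emb) = ((A.restrict S T s F).innerStates π).map Subtype.val := by
  simp only [innerStates, ← List.map_tail, List.map_map]
  rfl

theorem exists_emb_eq {t : A.trans} (ht : t ∈ T) (h₁ : A.src t ∈ S) (h₂ : A.tgt t ∈ S) :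
    ∃ x : (A.restrict S T s F).trans, emb x = t :=
  ⟨⟨(⟨_, h₁⟩, A.letter t, ⟨_, h₂⟩), t, ht, rfl⟩, rfl⟩

theorem exists_map_emb_eq (hT : ∀ t ∈ T, A.src t ∈ S ∧ A.tgt t ∈ S) {π : List A.trans}
    (hπ : ∀ t ∈ π, t ∈ T) : ∃ ρ : List (A.restrict S T s F).trans, ρ.map emb = π := by
  induction π with
  | nil => exact ⟨[], rfl⟩
  | cons t π ih =>
    obtain ⟨ρ, rfl⟩ := ih fun t ht => hπ t (List.mem_cons_of_mem _ ht)
    have ht := hπ t (by simp)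
    obtain ⟨x, rfl⟩ := exists_emb_eq (s := s) (F := F) ht (hT t ht).1 (hT t ht).2
    exact ⟨x :: ρ, rfl⟩

theorem Reaches.of_restrict {p q : S} (h : (A.restrict S T s F).Reaches p q) :
    A.Reaches p.1 q.1 :=
  h.imp' (List.map emb) fun _ => isPath_map_emb.2

theorem CyclesDisjoint.restrict (hA : A.CyclesDisjoint) :
    (A.restrict S T s F).CyclesDisjoint := fun _ _ hs h h' =>
  emb_injective (hA _ _ (congrArg Subtype.val hs) h.of_restrict h'.of_restrict)

theorem IsDeterministic.restrict (hA : A.IsDeterministic) :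
    (A.restrict S T s F).IsDeterministic := fun p a q q' h h' =>
  Subtype.ext (hA p.1 a q.1 q'.1 (emb ⟨_, h⟩).2 (emb ⟨_, h'⟩).2)

end Restrict

/-! ### Simple paths and their return paths -/

/-- A sequence of states `v` joined by transitions `e`. -/
def IsSpine {n : ℕ} (A : Automaton α σ) (v : Fin (n + 1) → σ) (e : Fin n → A.trans) : Prop :=
  Function.Injective v ∧ ∀ i, A.src (e i) = v i.castSucc ∧ A.tgt (e i) = v i.succ

theorem IsPath.exists_isSpine {p q : σ} {π : List A.trans} (h : A.IsPath p π q)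
    (hnd : (p :: π.map A.tgt).Nodup) :
    ∃ (n : ℕ) (v : Fin (n + 1) → σ) (e : Fin n → A.trans), A.IsSpine v e ∧
      v 0 = p ∧ v (Fin.last n) = q ∧ (∀ t, t ∈ π ↔ t ∈ Set.range e) ∧
      ∀ s, s ∈ p :: π.map A.tgt ↔ s ∈ Set.range v := by
  induction π generalizing p with
  | nil =>
    refine ⟨0, fun _ => p, Fin.elim0, ⟨fun i j _ => Fin.ext (by omega), fun i => i.elim0⟩,
      rfl, h, by simp, by simp [eq_comm]⟩
  | cons t π ih =>
    obtain ⟨rfl, h⟩ := h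
    rw [List.map_cons, List.nodup_cons] at hnd
    obtain ⟨n, v, e, ⟨hv, he⟩, h0, hl, ht, hs⟩ := ih h hnd.2
    refine ⟨n + 1, Fin.cons (A.src t) v, Fin.cons t e, ⟨?_, ?_⟩, rfl, ?_, ?_, ?_⟩
    · exact Fin.cons_injective_iff.2 ⟨fun hr => hnd.1 ((hs _).2 hr), hv⟩
    · intro i
      refine Fin.cases ?_ (fun i => ?_) i
      · exact ⟨rfl, h0.symm⟩
      · exact he i
    · exact hl
    · intro u
      rw [Fin.range_cons, List.mem_cons, ht]
      rfl
    · intro u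
      rw [Fin.range_cons, List.map_cons, List.mem_cons, hs]
      rfl

section Spine

variable {n : ℕ} {v : Fin (n + 1) → σ} {e : Fin n → A.trans}

/-- The bound `i ≤ k.castSucc` records that the path never goes back to a spine state before `v i`.
-/
theorem IsSpine.exists_isPath (h : A.IsSpine v e) {i j : Fin (n + 1)} (hij : i ≤ j) :
    ∃ π, A.IsPath (v i) π (v j) ∧ ∀ t ∈ π, ∃ k, i ≤ k.castSucc ∧ e k = t := by
  induction j using Fin.induction with
  | zero => exact ⟨[], congrArg v (Fin.le_zero_iff.1 hij), by simp⟩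
  | succ k ih =>
    rcases hij.eq_or_lt with rfl | hlt
    · exact ⟨[], rfl, by simp⟩
    · have hik : i ≤ k.castSucc := Fin.le_castSucc_iff.2 hlt
      obtain ⟨π, hπ, hk⟩ := ih hik
      refine ⟨π ++ [e k], hπ.append ⟨(h.2 k).1, (h.2 k).2⟩, fun t ht => ?_⟩
      rcases List.mem_append.1 ht with ht | ht
      · exact hk t ht
      · exact ⟨k, hik, (List.mem_singleton.1 ht).symm⟩

theorem IsSpine.reaches (h : A.IsSpine v e) {i j : Fin (n + 1)} (hij : i ≤ j) :
    A.Reaches (v i) (v j) := let ⟨π, hπ, _⟩ := h.exists_isPath hij; ⟨π, hπ⟩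

/-- `π` is the shortest way back from the last state of the spine in a strongly connected
component, `v i`, to the first one, `v j`. -/
structure IsReturn (A : Automaton α σ) (v : Fin (n + 1) → σ) (i j : Fin (n + 1))
    (π : List A.trans) : Prop where
  le : j ≤ i
  max : ∀ k, A.Reaches (v k) (v i) → k ≤ i
  min : ∀ k, A.Reaches (v i) (v k) → j ≤ k
  ne_nil : π ≠ []
  isPath : A.IsPath (v i) π (v j)
  nodup : (A.innerStates π).Nodup
  hi_notMem : v i ∉ A.innerStates π
  lo_notMem : v j ∉ A.innerStates π

theorem exists_isReturn {i : Fin (n + 1)} {c : List A.trans}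
    (hc : A.IsPath (v i) c (v i)) (hc₀ : c ≠ []) (hmax : ∀ k, A.Reaches (v k) (v i) → k ≤ i) :
    ∃ j π, A.IsReturn v i j π := by
  classical
  obtain ⟨j, hj, hmin⟩ := (Set.toFinite {k | A.Reaches (v i) (v k)}).exists_minimal
    ⟨i, .refl (v i)⟩
  obtain ⟨ρ, hρ⟩ := hj
  -- Going round c first keeps the path nonempty when j = i.
  obtain ⟨π, h₁, h₂, h₃, h₄, h₅⟩ := (hc.append hρ).exists_innerStates_nodup (by simp [hc₀])
  have hmin' : ∀ k, A.Reaches (v i) (v k) → j ≤ k := fun k hk =>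
    (le_total j k).elim id fun hkj => hmin hk hkj
  exact ⟨j, π, hmin' i (.refl _), hmax, hmin', h₁, h₂, h₃, h₄, h₅⟩

namespace IsReturn

variable {i j i' j' : Fin (n + 1)} {π π' : List A.trans}

theorem reaches_of_mem_Icc (hR : A.IsReturn v i j π) (h : A.IsSpine v e) {k : Fin (n + 1)}
    (hk : k ∈ Set.Icc j i) : A.Reaches (v k) (v i) ∧ A.Reaches (v i) (v k) :=
  ⟨h.reaches hk.2, hR.isPath.reaches.trans (h.reaches hk.1)⟩

/-- Each strongly connected component has at most one last spine state, so return paths with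
different starting points lie in different components. This gives both their disjointness and the
absence of nesting. -/
theorem hi_eq (hR : A.IsReturn v i j π) (hR' : A.IsReturn v i' j' π') {s : σ}
    (h₁ : A.Reaches (v i) s) (h₂ : A.Reaches s (v i)) (h₁' : A.Reaches (v i') s)
    (h₂' : A.Reaches s (v i')) : i = i' :=
  le_antisymm (hR'.max _ (h₁.trans h₂')) (hR.max _ (h₁'.trans h₂))

theorem reaches_of_mem_innerStates (hR : A.IsReturn v i j π) (h : A.IsSpine v e) {s : σ}
    (hs : s ∈ A.innerStates π) : A.Reaches (v i) s ∧ A.Reaches s (v i) :=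
  ⟨(Reaches.of_mem_innerStates hR.isPath hs).1,
    (Reaches.of_mem_innerStates hR.isPath hs).2.trans (h.reaches hR.le)⟩

/-- Suppose π meets the spine inside, at `v k`; then j < k ≤ i. The rest of π and the spine from `v
k` to `v i` stay in one component, so one is a prefix of the other. The rest of π cannot follow the
spine to `v j`, which lies behind; otherwise it passes through `v i`, which is no intermediate state
of π. -/
theorem notMem_range (hA : A.CyclesDisjoint) (hR : A.IsReturn v i j π) (h : A.IsSpine v e) {s : σ}
    (hs : s ∈ A.innerStates π) : s ∉ Set.range v := by
  rintro ⟨k, rfl⟩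
  obtain ⟨h₁, h₂⟩ := hR.reaches_of_mem_innerStates h hs
  have hki := hR.max k h₂
  have hjk := hR.min k h₁
  have hjk' : j ≠ k := by rintro rfl; exact hR.lo_notMem hs
  have hij : i ≠ j := by rintro rfl; exact hjk' (le_antisymm hjk hki)
  obtain ⟨u, hu, huk⟩ := List.mem_map.1 hs
  have hsplit : ∃ b, A.IsPath (v k) (u :: b) (v j) ∧ ∀ x ∈ u :: b, A.src x ∈ A.innerStates π := by
    have hR' := hR.isPath
    simp only [innerStates]
    cases π with
    | nil => simp at hu
    | cons t τ =>
      obtain ⟨a, b, rfl, -, hb⟩ := hR'.2.exists_eq_append_cons hu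
      exact ⟨b, ⟨huk, hb⟩, fun x hx => List.mem_map_of_mem (by simp_all)⟩
  obtain ⟨b, hb, hsub⟩ := hsplit
  obtain ⟨ρ, hρ, hρe⟩ := h.exists_isPath hki
  rcases hA.prefix_or_prefix hb hρ (h.reaches hjk) h₁ with hp | ⟨r, hr⟩
  · obtain ⟨x, hx, hxj⟩ := hb.exists_tgt_eq (by simp)
    obtain ⟨l, hl, rfl⟩ := hρe x (hp.subset hx)
    have := h.1 ((h.2 l).2.symm.trans hxj)
    exact absurd (this ▸ hjk) (not_le.2 (lt_of_le_of_lt hl Fin.castSucc_lt_succ))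
  · rw [← hr] at hb hsub
    obtain ⟨s, hs₁, hs₂⟩ := isPath_append.1 hb
    obtain rfl := hρ.tgt_unique hs₁
    cases r with
    | nil => exact hij (h.1 hs₂)
    | cons x r =>
      have := hsub x (by simp)
      rw [hs₂.1] at this
      exact hR.hi_notMem this

end IsReturn

/-- Each transition on a cycle that meets the component of a state of the spine is on the spine
or on a return path. -/
theorem IsSpine.mem_range_or_mem_of_cyclic (hA : A.CyclesDisjoint) (h : A.IsSpine v e)
    {t : A.trans} (ht : A.Reaches (A.tgt t) (A.src t)) {k : Fin (n + 1)}
    (h₁ : A.Reaches (A.src t) (v k)) (h₂ : A.Reaches (v k) (A.src t)) :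
    ∃ i, (∃ j π, A.IsReturn v i j π) ∧ ∀ j π, A.IsReturn v i j π → t ∈ Set.range e ∨ t ∈ π := by
  -- This i is the last spine index in the component of `v k`, as `v k` reaches `v i` along the
  -- spine.
  obtain ⟨i, hi, hmax⟩ := (Set.toFinite {i | A.Reaches (v i) (v k)}).exists_maximal
    ⟨k, .refl (v k)⟩
  have hmax' : ∀ l, A.Reaches (v l) (v i) → l ≤ i := fun l hl =>
    (le_total l i).elim id fun hil => hmax (hl.trans hi) hil
  have hki : k ≤ i := (le_total k i).elim id fun hik => hmax (.refl _) hik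
  have hit : A.Reaches (v i) (A.src t) := Reaches.trans hi h₂
  have hti : A.Reaches (A.tgt t) (v i) := ht.trans (h₁.trans (h.reaches hki))
  obtain ⟨a, ha⟩ := hit
  obtain ⟨b, hb⟩ := hti
  refine ⟨i, exists_isReturn (ha.append (π' := t :: b) ⟨rfl, hb⟩) (by simp) hmax', ?_⟩
  intro j π hR
  obtain ⟨ρ, hρ, hρe⟩ := h.exists_isPath hR.le
  -- The return path and the spine from `v j` to `v i` form a closed path, which runs through every
  -- transition of the component.
  have := hA.subset_of_isPath (hR.isPath.append hρ) (by simp [hR.ne_nil])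
    (ha.append (π' := [t]) ⟨rfl, rfl⟩) ⟨b, hb⟩ (show t ∈ a ++ [t] by simp)
  rcases List.mem_append.1 this with h | h
  · exact .inr h
  · obtain ⟨l, -, hl⟩ := hρe t h
    exact .inl ⟨l, hl⟩

end Spine

/-- In an automaton with disjoint cycles, each path from the initial state is a path of a flat
automaton made of states and transitions of the automaton. -/
theorem CyclesDisjoint.exists_isFlat_restrict (hA : A.CyclesDisjoint) {p q : σ}
    {π : List A.trans} (hπ : A.IsPath p π q) :
    ∃ (S : Set σ) (T : Set A.trans) (s : S) (F : Set S), (A.restrict S T s F).IsFlat ∧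
      A.label π ∈ (A.restrict S T s F).language := by
  classical
  obtain ⟨ρ, hρ, hnd, hbr, hscc⟩ := hπ.exists_nodup
  obtain ⟨n, v, e, h, h0, hlast, hρe, hρv⟩ := hρ.exists_isSpine hnd
  -- One return path is chosen for each component that meets the spine and contains a cycle, indexed
  -- by its last spine state.
  let K := {i : Fin (n + 1) // ∃ j π, A.IsReturn v i j π}
  have hK : ∀ k : K, ∃ j π, A.IsReturn v k.1 j π := fun k => k.2
  choose lo back hR using hK
  let ε : Fin (Fintype.card K) ≃ K := (Fintype.equivFin K).symm
  have hε : ∀ k l, (ε k).1 = (ε l).1 → k = l := fun k l hkl => ε.injective (Subtype.ext hkl)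
  let S : Set σ := {s | s ∈ Set.range v ∨ ∃ k, s ∈ A.innerStates (back (ε k))}
  let T : Set A.trans := {t | t ∈ Set.range e ∨ ∃ k, t ∈ back (ε k)}
  have hvS : ∀ i, v i ∈ S := fun i => .inl ⟨i, rfl⟩
  have hT : ∀ t ∈ T, A.src t ∈ S ∧ A.tgt t ∈ S := by
    rintro t (⟨i, rfl⟩ | ⟨k, hk⟩)
    · rw [(h.2 i).1, (h.2 i).2]
      exact ⟨hvS _, hvS _⟩
    · constructor
      · rcases (hR (ε k)).isPath.src_mem hk with hs | hs
        · exact hs ▸ hvS _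
        · exact .inr ⟨k, hs⟩
      · rcases (hR (ε k)).isPath.tgt_mem hk with hs | hs
        · exact hs ▸ hvS _
        · exact .inr ⟨k, hs⟩
  have hπT : ∀ t ∈ π, t ∈ T := by
    intro t ht
    by_cases hc : A.Reaches (A.tgt t) (A.src t)
    · have hst : A.src t ∈ p :: π.map A.tgt := by
        rw [hπ.cons_map_tgt]
        exact List.mem_append_left _ (List.mem_map_of_mem ht)
      obtain ⟨s, hs, h₁, h₂⟩ := hscc _ hst
      obtain ⟨k, rfl⟩ := (hρv s).1 hs
      obtain ⟨i, hi, hit⟩ := h.mem_range_or_mem_of_cyclic hA hc h₁ h₂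
      rcases hit _ _ (hR ⟨i, hi⟩) with hit | hit
      · exact .inl hit
      · refine .inr ⟨ε.symm ⟨i, hi⟩, ?_⟩
        rw [Equiv.apply_symm_apply]
        exact hit
    · exact .inl ((hρe t).1 (hbr t ht hc))
  let s : S := ⟨v 0, hvS 0⟩
  let F : Set S := {⟨v (Fin.last n), hvS _⟩}
  have hlift : ∀ k, ∃ b : List (A.restrict S T s F).trans, b.map emb = back (ε k) := fun k =>
    exists_map_emb_eq hT fun t ht => .inr ⟨k, ht⟩
  choose b hb using hlift
  have hinner : ∀ k (x : S), x ∈ (A.restrict S T s F).innerStates (b k) ↔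
      x.1 ∈ A.innerStates (back (ε k)) := by
    intro k x
    rw [← hb, innerStates_map_emb, List.mem_map_of_injective Subtype.val_injective]
  refine ⟨S, T, s, F, ⟨?_⟩, ?_⟩
  · refine
      { n := n
        spine := fun i => ⟨v i, hvS i⟩
        m := Fintype.card K
        hi := fun k => (ε k).1
        lo := fun k => lo (ε k)
        back := b
        spine_injective := fun i j hij => h.1 (congrArg Subtype.val hij)
        start_eq := rfl
        accept_eq := rfl
        spine_step := ?_
        lo_le_hi := fun k => (hR _).le
        back_ne_nil := ?_
        back_isPath := ?_
        back_fresh := ?_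
        back_nodup := ?_
        back_disjoint := ?_
        not_nested := ?_
        cover_states := ?_
        cover_trans := ?_ }
    · intro i
      obtain ⟨x, hx⟩ := exists_emb_eq (s := s) (F := F) (show e i ∈ T from .inl ⟨i, rfl⟩)
        (hT _ (.inl ⟨i, rfl⟩)).1 (hT _ (.inl ⟨i, rfl⟩)).2
      refine ⟨x, ⟨Subtype.ext ?_, Subtype.ext ?_⟩, ?_⟩
      · rw [← src_emb, hx]; exact (h.2 i).1
      · rw [← tgt_emb, hx]; exact (h.2 i).2
      · rintro y ⟨hy₁, hy₂⟩
        have hy₁' : A.src (emb y) = v i.castSucc := congrArg Subtype.val hy₁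
        have hy₂' : A.tgt (emb y) = v i.succ := congrArg Subtype.val hy₂
        refine emb_injective (Eq.trans ?_ hx.symm)
        rcases emb_mem y with ⟨j, hj⟩ | ⟨k, hk⟩
        · rw [← hj, (h.2 j).1] at hy₁'
          rw [← hj, Fin.castSucc_injective n (h.1 hy₁')]
        -- A return transition parallel to the spine step would start at the last spine state of its
        -- component, while its target, the next spine state, leads back to it.
        · exfalso
          rcases (hR (ε k)).isPath.src_mem hk with hs | hs
          · have h₁ : (ε k).1 = i.castSucc := h.1 (hs.symm.trans hy₁')
            have h₂ := ((hR (ε k)).isPath.tgt_reaches hk).trans (h.reaches (hR (ε k)).le)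
            rw [hy₂'] at h₂
            have h₃ := (hR (ε k)).max _ h₂
            rw [h₁] at h₃
            exact absurd h₃ (not_le.2 Fin.castSucc_lt_succ)
          · exact (hR (ε k)).notMem_range hA h hs ⟨_, hy₁'.symm⟩
    · intro k hk
      have := hb k
      rw [hk] at this
      exact (hR (ε k)).ne_nil this.symm
    · intro k
      rw [← isPath_map_emb, hb]
      exact (hR (ε k)).isPath
    · rintro k x hx ⟨i, rfl⟩
      exact (hR (ε k)).notMem_range hA h ((hinner k _).1 hx) ⟨i, rfl⟩
    · intro k
      refine List.Nodup.of_map Subtype.val ?_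
      rw [← innerStates_map_emb, hb]
      exact (hR (ε k)).nodup
    · intro k l hkl x hxk hxl
      obtain ⟨h₁, h₂⟩ := (hR (ε k)).reaches_of_mem_innerStates h ((hinner k x).1 hxk)
      obtain ⟨h₁', h₂'⟩ := (hR (ε l)).reaches_of_mem_innerStates h ((hinner l x).1 hxl)
      exact hkl (hε k l ((hR _).hi_eq (hR _) h₁ h₂ h₁' h₂'))
    · intro k l hkl
      have key : ∀ i ∈ Set.Icc (lo (ε l)) (ε l).1, i ∉ Set.Icc (lo (ε k)) (ε k).1 := by
        intro i hi hi'
        obtain ⟨h₁, h₂⟩ := (hR (ε k)).reaches_of_mem_Icc h hi'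
        obtain ⟨h₁', h₂'⟩ := (hR (ε l)).reaches_of_mem_Icc h hi
        exact hkl (hε k l ((hR _).hi_eq (hR _) h₂ h₁ h₂' h₁'))
      exact ⟨key _ ⟨le_rfl, (hR _).le⟩, key _ ⟨(hR _).le, le_rfl⟩⟩
    · rintro ⟨x, ⟨i, rfl⟩ | ⟨k, hk⟩⟩
      · exact .inl ⟨i, rfl⟩
      · exact .inr ⟨k, (hinner k _).2 hk⟩
    · intro x
      rcases emb_mem x with ⟨i, hi⟩ | ⟨k, hk⟩
      · refine .inl ⟨i, Subtype.ext ?_, Subtype.ext ?_⟩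
        · rw [← src_emb, ← hi]; exact (h.2 i).1
        · rw [← tgt_emb, ← hi]; exact (h.2 i).2
      · rw [← hb, List.mem_map_of_injective emb_injective] at hk
        exact .inr ⟨k, hk⟩
  · obtain ⟨τ, hτ⟩ := exists_map_emb_eq (s := s) (F := F) hT hπT
    refine ⟨τ, ⟨⟨v (Fin.last n), hvS _⟩, rfl, ?_⟩, ?_⟩
    · rw [← isPath_map_emb, hτ]
      change A.IsPath (v 0) π (v (Fin.last n))
      rw [h0, hlast]
      exact hπ
    · rw [← label_map_emb, hτ]

end Automaton
end BoundedParikh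

/-! ### Constraining by a Parikh automaton, and the theorem -/

namespace BoundedParikh

variable {α : Type*}

/-- The constrained automaton with underlying automaton `A` that accepts the words of the language
of a Parikh automaton `M`. -/
def constrain [Finite α] {S : Type} [Finite S] (A : Automaton α S) (M : ParikhAutomaton α) :
    ConstrainedAutomaton α where
  State := S
  finite_state := inferInstance
  aut := A
  constr := {v | ∃ π ∈ A.runs, A.label π ∈ M.language ∧ parikh π = v}
  semilinear := ParikhAutomaton.isSemilinearSet_parikh_runs A M

/-- The constraint only compares Parikh images; disjointness of cycles makes a run equal to the
witness with the same image, so their labels agree. -/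
theorem mem_language_constrain [Finite α] {S : Type} [Finite S] {A : Automaton α S}
    (hA : A.CyclesDisjoint) {M : ParikhAutomaton α} {w : List α} :
    w ∈ (constrain A M).language ↔ w ∈ A.language ∧ w ∈ M.language := by
  constructor
  · rintro ⟨π, ⟨q, hq, hπ⟩, ⟨ρ, ⟨r, hr, hρ⟩, hl, he⟩, rfl⟩
    obtain rfl := hA.eq_of_parikh_eq hρ hπ he
    exact ⟨⟨ρ, ⟨r, hr, hρ⟩, rfl⟩, hl⟩
  · rintro ⟨⟨π, hπ, rfl⟩, hl⟩
    exact ⟨π, hπ, ⟨π, hπ, hl, rfl⟩, rfl⟩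

namespace ConstrainedAutomaton

/-- A deterministic constrained automaton is equivalent to a deterministic Parikh automaton. -/
theorem IsDeterministic.exists_parikhAutomaton [Finite α] {M : ConstrainedAutomaton α}
    (hM : M.IsDeterministic) :
    ∃ P : ParikhAutomaton α, P.IsDeterministic ∧ P.language = M.language := by
  classical
  have := M.finite_state
  let k := Nat.card M.aut.trans
  -- The dimension must be positive even without transitions; the last coordinate is a dummy, always
  -- zero on labels and ignored by the constraint.
  let f : M.aut.trans → Fin (k + 1) := fun t => (Finite.equivFin M.aut.trans t).castSucc
  have hf : Function.Injective f :=
    (Fin.castSucc_injective _).comp (Finite.equivFin M.aut.trans).injective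
  let vec : M.aut.trans → Fin (k + 1) → ℕ := fun t => Pi.single (f t) 1
  have := Fintype.ofFinite M.aut.trans
  let D : Finset (Fin (k + 1) → ℕ) := Finset.univ.image vec
  have hD : ∀ t, vec t ∈ D := fun t => Finset.mem_image_of_mem _ (Finset.mem_univ t)
  let P : ParikhAutomaton α :=
    { d := k + 1
      d_pos := Nat.succ_pos k
      D := D
      State := M.State
      finite_state := M.finite_state
      aut :=
        { trans := Set.range fun t =>
            (M.aut.src t, (M.aut.letter t, (⟨vec t, hD t⟩ : D)), M.aut.tgt t)
          start := M.aut.start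
          accept := M.aut.accept }
      constr := LinearMap.funLeft ℕ ℕ f ⁻¹' M.constr
      semilinear := M.semilinear.preimage (LinearMap.funLeft ℕ ℕ f) }
  let u : M.aut.trans → P.aut.trans := fun t => ⟨_, t, rfl⟩
  have hu : Function.Surjective u := by
    rintro ⟨_, t, rfl⟩
    exact ⟨t, rfl⟩
  have hpath : ∀ (π : List M.aut.trans) p q,
      P.aut.IsPath p (π.map u) q ↔ M.aut.IsPath p π q := by
    intro π
    induction π with
    | nil => exact fun p q => Iff.rfl
    | cons t π ih => exact fun p q => and_congr Iff.rfl (ih _ _)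
  have hproj : ∀ π : List M.aut.trans, P.proj (P.aut.label (π.map u)) = M.aut.label π := by
    intro π
    simp only [ParikhAutomaton.proj, Automaton.label, List.map_map]
    rfl
  have hparikh : ∀ π : List M.aut.trans,
      LinearMap.funLeft ℕ ℕ f (P.extParikh (P.aut.label (π.map u))) = parikh π := by
    intro π
    induction π with
    | nil =>
      rw [parikh_nil]
      rfl
    | cons t π ih =>
      have h₁ : P.extParikh (P.aut.label ((t :: π).map u)) =
          vec t + P.extParikh (P.aut.label (π.map u)) := rfl
      rw [h₁, map_add, ih, parikh_cons]
      congr 1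
      ext x
      by_cases hx : x = t
      · subst hx
        simp [vec, LinearMap.funLeft_apply, parikh]
      · simp [vec, LinearMap.funLeft_apply, parikh, hf.eq_iff, hx, Ne.symm hx]
  refine ⟨P, ?_, ?_⟩
  · rintro q a q₁ v₁ q₂ v₂ ⟨t₁, h₁⟩ ⟨t₂, h₂⟩
    simp only [Prod.mk.injEq] at h₁ h₂
    obtain ⟨rfl, ⟨rfl, rfl⟩, rfl⟩ := h₁
    obtain ⟨hs, ⟨hl, rfl⟩, rfl⟩ := h₂
    have : t₁ = t₂ := by
      refine Subtype.ext (Prod.ext hs.symm (Prod.ext hl.symm ?_))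
      refine hM _ _ _ _ t₁.2 ?_
      have h₂ : (M.aut.src t₂, M.aut.letter t₂, M.aut.tgt t₂) ∈ M.aut.trans := t₂.2
      rw [hs, hl] at h₂
      exact h₂
    rw [this]
  · ext w
    constructor
    · rintro ⟨_, ⟨ρ, ⟨q, hq, hρ⟩, rfl⟩, hC, rfl⟩
      obtain ⟨π, rfl⟩ := List.map_surjective_iff.2 hu ρ
      refine ⟨π, ⟨q, hq, (hpath _ _ _).1 hρ⟩, ?_, (hproj π).symm⟩
      rw [← hparikh]
      exact hC
    · rintro ⟨π, ⟨q, hq, hπ⟩, hC, rfl⟩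
      refine ⟨_, ⟨π.map u, ⟨q, hq, (hpath _ _ _).2 hπ⟩, rfl⟩, ?_, hproj π⟩
      rw [← hparikh] at hC
      exact hC

end ConstrainedAutomaton

/-- A bounded language is contained in the language of a deterministic automaton with disjoint
cycles. -/
theorem IsBounded.exists_automaton {L : Language α} (hL : IsBounded L) :
    ∃ (Q : Type) (_ : Finite Q) (A : Automaton α Q), A.IsDeterministic ∧ A.CyclesDisjoint ∧
      L ≤ A.language := by
  obtain ⟨ws, -, hws, hle⟩ := hL
  obtain ⟨Q, _, D, hD⟩ := isRegular_prod_kstar ws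
  have hg := hasPolynomialGrowth_prod_kstar ws hws
  rw [← hD] at hg hle
  exact ⟨Q, inferInstance, trim D, isDeterministic_trim, cyclesDisjoint_trim hg,
    hle.trans accepts_le_language_trim⟩

instance Automaton.instFinite {S : Type*} [Finite α] [Finite S] : Finite (Automaton α S) :=
  Finite.of_injective (fun A : Automaton α S => (A.trans, A.start, A.accept)) (by
    rintro ⟨⟩ ⟨⟩ h
    simpa using h)

/-- A bounded language recognized by a Parikh automaton is the union of the languages of finitely
many flat deterministic constrained automata. -/
theorem exists_eq_iSup_language_of_mem_boundedPA [Finite α] : ∀ L ∈ boundedPA α,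
    ∃ (m : ℕ) (M : Fin m → ConstrainedAutomaton α),
      (∀ i, (M i).IsDeterministic ∧ (M i).IsFlat) ∧ L = ⨆ i, (M i).language := by
  rintro L ⟨⟨P, rfl⟩, hL⟩
  obtain ⟨Q, _, A, hdet, hA, hle⟩ := hL.exists_automaton
  -- A finite index set, independent of the run. It may contain automata unrelated to `A`, which is
  -- harmless since `constrain` accepts only words of `P`.
  let I := {x : Σ S : Set Q, Automaton α S //
    x.2.IsDeterministic ∧ x.2.IsFlat ∧ x.2.CyclesDisjoint}
  let ε : Fin (Nat.card I) ≃ I := (Finite.equivFin I).symm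
  refine ⟨Nat.card I, fun i => constrain (ε i).1.2 P,
    fun i => ⟨(ε i).2.1, (ε i).2.2.1⟩, le_antisymm ?_ (iSup_le fun i w hw => ?_)⟩
  · intro w hw
    obtain ⟨π, ⟨q, hq, hπ⟩, rfl⟩ := hle hw
    obtain ⟨S, T, s, F, hflat, hmem⟩ := hA.exists_isFlat_restrict hπ
    refine le_iSup (fun i => (constrain (ε i).1.2 P).language)
      (ε.symm ⟨⟨S, A.restrict S T s F⟩, hdet.restrict, hflat, hA.restrict⟩)
      ((mem_language_constrain (ε _).2.2.2).2 ⟨?_, hw⟩)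
    rw [Equiv.apply_symm_apply]
    exact hmem
  · exact ((mem_language_constrain (ε i).2.2.2).1 hw).2

/-- On bounded languages, deterministic Parikh automata are as powerful as Parikh automata. -/
theorem boundedPA_eq_boundedDetPA [Finite α] : boundedPA α = boundedDetPA α := by
  ext L
  constructor
  · rintro ⟨⟨P, rfl⟩, hL⟩
    obtain ⟨Q, _, A, hdet, hA, hle⟩ := hL.exists_automaton
    -- No flatness is needed here: `A` itself is constrained, and its language contains that of `P`.
    obtain ⟨P', hP', hlang⟩ := ConstrainedAutomaton.IsDeterministic.exists_parikhAutomaton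
      (M := constrain A P) hdet
    refine ⟨⟨P', hP', hlang.trans ?_⟩, hL⟩
    ext w
    exact (mem_language_constrain hA).trans ⟨fun h => h.2, fun h => ⟨hle h, h⟩⟩
  · rintro ⟨⟨P, -, rfl⟩, hL⟩
    exact ⟨⟨P, rfl⟩, hL⟩

end BoundedParikh

theorem theorem3 {α : Type*} [Finite α] :
    (∀ L ∈ BoundedParikh.boundedPA α,
      ∃ (m : ℕ) (M : Fin m → BoundedParikh.ConstrainedAutomaton α),
        (∀ i, (M i).IsDeterministic ∧ (M i).IsFlat) ∧ L = ⨆ i, (M i).language) ∧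
    BoundedParikh.boundedPA α = BoundedParikh.boundedDetPA α :=
  ⟨BoundedParikh.exists_eq_iSup_language_of_mem_boundedPA,
    BoundedParikh.boundedPA_eq_boundedDetPA⟩
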